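/- **Setting.** Let $\mathcal V=(\mathcal V,\otimes,k)$ be a commutative unital quantale with internal hom $\hom$, and let $(\mathbb T,\mathcal V,\xi)$ be a (strict) topological theory with $T1=1$. That is: $\mathbb T=(T,e,m)$ is a monad on $\mathsf{Set}$ such that $T$ preserves weak pullbacks and every naturality square of $m$ is a weak pullback; $\xi:T\mathcal V\to\mathcal V$ is an Eilenberg--Moore algebra for $\mathbb T$ for which $\otimes:\mathcal V\times\mathcal V\to\mathcal V$ and $k:1\to\mathcal V$ are $\mathbb T$-homomorphisms; and the maps $\mathcal V^X\to\mathcal V^{TX}$, $\varphi\mapsto\xi\cdot T\varphi$, are monotone and natural in $X$ with respect to direct images, i.e. $\xi\cdot T(f_!\varphi)=(Tf)_!(\xi\cdot T\varphi)$ for all $f:X\to Y$ and $\varphi:X\to\mathcal V$, where $f_!\varphi(y)=\bigvee_{f(x)=y}\varphi(x)$. A $\mathcal V$-relation $r:X\nrightarrow Y$ is a map $r:X\times Y\to\mathcal V$. Composition is $(s\cdot r)(x,z)=\bigvee_y r(x,y)\otimes s(y,z)$, functions are regarded as $\mathcal V$-relations via their graphs, $r^\circ(y,x)=r(x,y)$,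 and $T_\xi r:TX\nrightarrow TY$ is $$T_\xi r(\mathfrak x,\mathfrak y)=\bigvee\{\xi(Tr(\mathfrak w))\mid \mathfrak w\in T(X\times Y),\ T\pi_1(\mathfrak w)=\mathfrak x,\ T\pi_2(\mathfrak w)=\mathfrak y\}.$$ A $\mathbb T$-category $X=(X,a)$ is a set $X$ with $a:TX\nrightarrow X$ such that $k\le a(e_X(x),x)$ and $T_\xi a(\mathfrak X,\mathfrak x)\otimes a(\mathfrak x,x)\le a(m_X(\mathfrak X),x)$. A $\mathbb T$-functor $f:(X,a)\to(Y,b)$ is a map with $a(\mathfrak x,x)\le b(Tf(\mathfrak x),f(x))$. Write $X_0=(X,a_0)$, $a_0=a\cdot e_X$, for the underlying $\mathcal V$-category. For maps $f,g$ into $(Y,b)$ put $f\le g$ iff $k\le b_0(f(x),g(x))$ for all $x$, and $f\simeq g$ iff $f\le g\le f$. The $\mathbb T$-category $TX$ is $(TX,T_\xi a\cdot m_X^\circ\cdot m_X)$. $X$ is *representable* if there is a $\mathbb T$-functor $\alpha:TX\to X$ left adjoint to $e_X:X\to TX$ (that is, $1_{TX}\le e_X\cdot\alpha$ and $\alpha\cdot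 e_X\le 1_X$). A *pseudo-homomorphism* between representable $\mathbb T$-categories, with such left adjoints $\alpha,\beta$, is a $\mathbb T$-functor $f:X\to Y$ with $\beta\cdot Tf\simeq f\cdot\alpha$. These form the category $\mathsf{Repr}(\mathbb T)$. **The monad $\mathbb V=(V,y,w)$ on $\mathsf{Repr}(\mathbb T)$.** The underlying set of $VX$ is the set of $\mathbb T$-functors $\varphi:(X,a)\to(\mathcal V,\hom_\xi)$, $\hom_\xi(\mathfrak v,v)=\hom(\xi(\mathfrak v),v)$. The structure of $VX=(\mathcal V^X)^{\mathrm{op}}$ is $(\mathfrak p,\varphi)\mapsto\bigwedge_{x}\hom(\varphi(x),\mu_X(\mathfrak p,x))$, where $\mu_X=a\cdot T_\xi\mathrm{ev}$ and $\mathrm{ev}(\varphi,x)=\varphi(x)$. For $\psi:TX\nrightarrow Y$ and $\varphi:X\to\mathcal V$ put $(\psi\circ\varphi)(y)=\bigvee_{\mathfrak x\in TX}\xi(T\varphi(\mathfrak x))\otimes\psi(\mathfrak x,y)$. For $f:X\to(Y,b)$, $Vf(\varphi)=f_\circledast\circ\varphi$ with $f_\circledast(\mathfrak x,y)=b(Tf(\mathfrak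 x),y)$. The unit is $y_X(x)=a_0(x,-)$, and the multiplication is $w_X(\Phi)=y_X^\circledast\circ\Phi$, where $y_X^\circledast(\mathfrak p,x)$ is the value of the structure of $VX$ at $(\mathfrak p,y_X(x))$. **The category $\mathsf{ReprDist}(\mathbb T)$.** Its objects are the representable $\mathbb T$-categories. A morphism $(X,a)\to(Y,b)$ is a $\mathcal V$-distributor $\psi:X_0\to Y_0$ (a $\mathcal V$-relation $\psi:X\nrightarrow Y$ with $\psi\cdot a_0\le\psi$ and $b_0\cdot\psi\le\psi$) such that $\psi\cdot a=b\cdot T_\xi\psi$. Composition is composition of $\mathcal V$-relations, and the identity on $X$ is $a_0$. **Theorem.** The Kleisli category $\mathsf{Repr}(\mathbb T)_{\mathbb V}$ of $\mathbb V$ is equivalent to $\mathsf{ReprDist}(\mathbb T)$. More precisely, there is an equivalence of categories $\mathsf{Repr}(\mathbb T)_{\mathbb V}\to\mathsf{ReprDist}(\mathbb T)$ which is the identity on objects and sends a morphism $r:X\to VY$ to the $\mathcal V$-relation $\bar r$ with $\bar r(x,y)=r(x)(y)$. -/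

import Mathlib

open CategoryTheory

universe u

/-! ## Quantale-valued relations -/

section DirectImage

variable {V : Type u} [CompleteLattice V]

/-- The left adjoint of the inverse image function `(Y → V) → (X → V)`, `φ ↦ φ ∘ f`. -/
def directImage {X Y : Type u} (f : X → Y) (φ : X → V) : Y → V :=
  fun y => ⨆ (x : X) (_ : f x = y), φ x

theorem directImage_le_iff {X Y : Type u} (f : X → Y) (φ : X → V) (ψ : Y → V) :
    directImage f φ ≤ ψ ↔ φ ≤ ψ ∘ f := by
  constructor
  · intro h x
    exact (le_iSup₂ (f := fun (x' : X) (_ : f x' = f x) => φ x') x rfl).trans (h (f x))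
  · intro h y
    refine iSup₂_le ?_
    rintro x rfl
    exact h x

end DirectImage

section Relations

variable {V : Type u} [CommMonoid V] [CompleteLattice V]

/-- The composite `s · r` of the `V`-relations `r : X ⇸ Y` and `s : Y ⇸ Z`. -/
def relComp {X Y Z : Type u} (s : Y → Z → V) (r : X → Y → V) : X → Z → V :=
  fun x z => ⨆ y, r x y * s y z

theorem le_relComp {X Y Z : Type u} {s : Y → Z → V} {r : X → Y → V} {x : X} {z : Z} (y : Y) :
    r x y * s y z ≤ relComp s r x z :=
  le_iSup (fun y => r x y * s y z) y

/-- `ψ : X ⇸ Y` is a `V`-distributor from `(X, a)` to `(Y, b)`: `ψ · a ≤ ψ` and `b · ψ ≤ ψ`. -/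
def IsVDistributor {X Y : Type u} (a : X → X → V) (b : Y → Y → V) (ψ : X → Y → V) : Prop :=
  relComp ψ a ≤ ψ ∧ relComp b ψ ≤ ψ

variable [IsQuantale V]

/-- The internal hom of the quantale: `x * y ≤ z ↔ x ≤ ihom y z`. -/
def ihom (y z : V) : V := Quantale.leftMulResiduation y z

theorem le_ihom {x y z : V} : x ≤ ihom y z ↔ x * y ≤ z :=
  Quantale.leftMulResiduation_le_iff_mul_le

theorem ihom_mul_le (y z : V) : ihom y z * y ≤ z := le_ihom.1 le_rfl

theorem qSup_mul_le {ι : Type u} {p : ι → Prop} {f : ι → V} {y z : V}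
    (h : ∀ i, p i → f i * y ≤ z) : (⨆ (i : ι) (_ : p i), f i) * y ≤ z :=
  le_ihom.1 (iSup₂_le fun i hi => le_ihom.2 (h i hi))

theorem mul_qSup_le {ι : Type u} {p : ι → Prop} {f : ι → V} {y z : V}
    (h : ∀ i, p i → y * f i ≤ z) : y * (⨆ (i : ι) (_ : p i), f i) ≤ z := by
  rw [mul_comm]
  exact qSup_mul_le fun i hi => (mul_comm _ _).trans_le (h i hi)

theorem relComp_mono {X Y Z : Type u} {s s' : Y → Z → V} {r r' : X → Y → V}
    (hs : s ≤ s') (hr : r ≤ r') : relComp s r ≤ relComp s' r' :=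
  fun x z => iSup_mono fun y => mul_le_mul' (hr x y) (hs y z)

theorem relComp_assoc {W X Y Z : Type u} (t : Y → Z → V) (s : X → Y → V) (r : W → X → V) :
    relComp t (relComp s r) = relComp (relComp t s) r := by
  funext w z
  simp only [relComp, Quantale.iSup_mul_distrib, Quantale.mul_iSup_distrib, mul_assoc]
  exact iSup_comm

end Relations

/-! ## Topological theories -/

/-- The square `f ∘ p = g ∘ q` of sets and functions is a weak pullback. -/
def IsWeakPullback {P A B C : Type u} (p : P → A) (q : P → B) (f : A → C) (g : B → C) : Prop :=
  f ∘ p = g ∘ q ∧ ∀ a b, f a = g b → ∃ x, p x = a ∧ q x = b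

/-- A (strict) topological theory over the commutative unital quantale `V`. -/
structure TopologicalTheory (V : Type u) [CommMonoid V] [CompleteLattice V] [IsQuantale V] where
  /-- the monad `(T, e, m)` on the category of sets -/
  monad : CategoryTheory.Monad (Type u)
  /-- the algebra structure on `V` -/
  ξ : monad.obj V → V
  preserves_weakPullback : ∀ {P A B C : Type u} (p : P → A) (q : P → B) (f : A → C) (g : B → C),
    IsWeakPullback p q f g →
      IsWeakPullback (monad.map (↾p)) (monad.map (↾q)) (monad.map (↾f)) (monad.map (↾g))
  mu_weakPullback : ∀ {X Y : Type u} (f : X → Y),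
    IsWeakPullback (monad.μ.app X) (monad.map (monad.map (↾f))) (monad.map (↾f)) (monad.μ.app Y)
  ξ_unit : ∀ v : V, ξ (monad.η.app V v) = v
  ξ_mult : ∀ w : monad.obj (monad.obj V), ξ (monad.map (↾ξ) w) = ξ (monad.μ.app V w)
  ξ_mul : ∀ w : monad.obj (V × V), ξ (monad.map (↾fun p : V × V => p.1 * p.2) w) =
    ξ (monad.map (↾(Prod.fst : V × V → V)) w) * ξ (monad.map (↾(Prod.snd : V × V → V)) w)
  ξ_one : ∀ t : monad.obj PUnit, ξ (monad.map (↾fun _ : PUnit => (1 : V)) t) = 1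
  ξ_mono : ∀ {X : Type u} (φ ψ : X → V), φ ≤ ψ →
    ∀ w : monad.obj X, ξ (monad.map (↾φ) w) ≤ ξ (monad.map (↾ψ) w)
  ξ_directImage : ∀ {X Y : Type u} (f : X → Y) (φ : X → V),
    (fun w : monad.obj Y => ξ (monad.map (↾directImage f φ) w)) =
      directImage (fun w : monad.obj X => monad.map (↾f) w) (fun w => ξ (monad.map (↾φ) w))

namespace TopologicalTheory

variable {V : Type u} [CommMonoid V] [CompleteLattice V] [IsQuantale V]
variable (𝕋 : TopologicalTheory V)

/-- The set `TX`. -/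
abbrev F (X : Type u) : Type u := 𝕋.monad.obj X

/-- The function `Tf : TX → TY`. -/
def map {X Y : Type u} (f : X → Y) (w : 𝕋.F X) : 𝕋.F Y := 𝕋.monad.map (↾f) w

/-- The unit `e : X → TX`. -/
def e {X : Type u} (x : X) : 𝕋.F X := 𝕋.monad.η.app X x

/-- The multiplication `m : TTX → TX`. -/
def m {X : Type u} (w : 𝕋.F (𝕋.F X)) : 𝕋.F X := 𝕋.monad.μ.app X w

theorem map_id {X : Type u} (w : 𝕋.F X) : 𝕋.map (fun x => x) w = w := by
  have h : (↾fun x : X => x) = 𝟙 X := rfl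
  simp [map, h]

theorem map_map {X Y Z : Type u} (f : X → Y) (g : Y → Z) (w : 𝕋.F X) :
    𝕋.map g (𝕋.map f w) = 𝕋.map (fun x => g (f x)) w := by
  have h : (↾fun x : X => g (f x)) = (↾f) ≫ (↾g) := rfl
  simp [map, h]

theorem map_e {X Y : Type u} (f : X → Y) (x : X) : 𝕋.map f (𝕋.e x) = 𝕋.e (f x) :=
  (ConcreteCategory.congr_hom (𝕋.monad.η.naturality (↾f)) x).symm

theorem map_m {X Y : Type u} (f : X → Y) (w : 𝕋.F (𝕋.F X)) :
    𝕋.map f (𝕋.m w) = 𝕋.m (𝕋.map (𝕋.map f) w) :=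
  (ConcreteCategory.congr_hom (𝕋.monad.μ.naturality (↾f)) w).symm

theorem m_e {X : Type u} (w : 𝕋.F X) : 𝕋.m (𝕋.e w) = w :=
  ConcreteCategory.congr_hom (𝕋.monad.left_unit X) w

theorem m_map_e {X : Type u} (w : 𝕋.F X) : 𝕋.m (𝕋.map 𝕋.e w) = w :=
  ConcreteCategory.congr_hom (𝕋.monad.right_unit X) w

theorem m_map_m {X : Type u} (w : 𝕋.F (𝕋.F (𝕋.F X))) : 𝕋.m (𝕋.map 𝕋.m w) = 𝕋.m (𝕋.m w) :=
  ConcreteCategory.congr_hom (𝕋.monad.assoc X) w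

/-! ## The extension of `T` to `V`-relations -/

/-- The `V`-relation `T_ξ r : TX ⇸ TY` for `r : X ⇸ Y`. -/
def ext {X Y : Type u} (r : X → Y → V) : 𝕋.F X → 𝕋.F Y → V :=
  fun 𝔵 𝔶 => ⨆ (w : 𝕋.F (X × Y)) (_ : 𝕋.map Prod.fst w = 𝔵 ∧ 𝕋.map Prod.snd w = 𝔶),
    𝕋.ξ (𝕋.map (fun p => r p.1 p.2) w)

theorem le_ext {X Y : Type u} (r : X → Y → V) (w : 𝕋.F (X × Y)) :
    𝕋.ξ (𝕋.map (fun p => r p.1 p.2) w) ≤ 𝕋.ext r (𝕋.map Prod.fst w) (𝕋.map Prod.snd w) :=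
  le_iSup₂ (f := fun (w' : 𝕋.F (X × Y)) (_ : 𝕋.map Prod.fst w' = 𝕋.map Prod.fst w ∧
    𝕋.map Prod.snd w' = 𝕋.map Prod.snd w) => 𝕋.ξ (𝕋.map (fun p => r p.1 p.2) w')) w ⟨rfl, rfl⟩

theorem ext_le {X Y : Type u} {r : X → Y → V} {s : 𝕋.F X → 𝕋.F Y → V}
    (h : ∀ w : 𝕋.F (X × Y), 𝕋.ξ (𝕋.map (fun p => r p.1 p.2) w) ≤
      s (𝕋.map Prod.fst w) (𝕋.map Prod.snd w)) : 𝕋.ext r ≤ s := by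
  intro 𝔵 𝔶
  refine iSup₂_le ?_
  rintro w ⟨rfl, rfl⟩
  exact h w

theorem ξ_map_mono {X : Type u} {φ ψ : X → V} (h : φ ≤ ψ) (w : 𝕋.F X) :
    𝕋.ξ (𝕋.map φ w) ≤ 𝕋.ξ (𝕋.map ψ w) := 𝕋.ξ_mono φ ψ h w

theorem ξ_map_mul {X : Type u} (φ ψ : X → V) (w : 𝕋.F X) :
    𝕋.ξ (𝕋.map (fun x => φ x * ψ x) w) = 𝕋.ξ (𝕋.map φ w) * 𝕋.ξ (𝕋.map ψ w) := by
  have h := 𝕋.ξ_mul (𝕋.map (fun x => (φ x, ψ x)) w)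
  change 𝕋.ξ (𝕋.map _ (𝕋.map _ w)) = 𝕋.ξ (𝕋.map _ (𝕋.map _ w)) * 𝕋.ξ (𝕋.map _ (𝕋.map _ w)) at h
  simpa only [map_map] using h

theorem ξ_map_one {X : Type u} (w : 𝕋.F X) : 𝕋.ξ (𝕋.map (fun _ => (1 : V)) w) = 1 := by
  have h := 𝕋.ξ_one (𝕋.map (fun _ => PUnit.unit) w)
  change 𝕋.ξ (𝕋.map _ (𝕋.map _ w)) = 1 at h
  simpa only [map_map] using h

theorem ξ_map_ξ {X : Type u} (φ : X → V) (w : 𝕋.F (𝕋.F X)) :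
    𝕋.ξ (𝕋.map (fun v => 𝕋.ξ (𝕋.map φ v)) w) = 𝕋.ξ (𝕋.map φ (𝕋.m w)) := by
  have h := 𝕋.ξ_mult (𝕋.map (𝕋.map φ) w)
  change 𝕋.ξ (𝕋.map _ (𝕋.map _ w)) = 𝕋.ξ (𝕋.m (𝕋.map _ w)) at h
  rw [map_map, ← map_m] at h
  exact h

theorem ξ_map_e {X : Type u} (φ : X → V) (x : X) : 𝕋.ξ (𝕋.map φ (𝕋.e x)) = φ x := by
  rw [map_e]
  exact 𝕋.ξ_unit _

theorem ξ_map_directImage {X Y : Type u} (f : X → Y) (φ : X → V) (w : 𝕋.F Y) :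
    𝕋.ξ (𝕋.map (directImage f φ) w) =
      ⨆ (v : 𝕋.F X) (_ : 𝕋.map f v = w), 𝕋.ξ (𝕋.map φ v) :=
  congrFun (𝕋.ξ_directImage f φ) w

theorem exists_of_weakPullback {P A B C : Type u} {p : P → A} {q : P → B} {f : A → C} {g : B → C}
    (h : IsWeakPullback p q f g) (a : 𝕋.F A) (b : 𝕋.F B) (hab : 𝕋.map f a = 𝕋.map g b) :
    ∃ x, 𝕋.map p x = a ∧ 𝕋.map q x = b :=
  (𝕋.preserves_weakPullback p q f g h).2 a b hab

theorem ext_mono {X Y : Type u} {r s : X → Y → V} (h : r ≤ s) : 𝕋.ext r ≤ 𝕋.ext s :=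
  𝕋.ext_le fun w => (𝕋.ξ_map_mono (fun p : X × Y => h p.1 p.2) w).trans (𝕋.le_ext s w)

theorem ext_comp {X Y Z : Type u} (s : Y → Z → V) (r : X → Y → V) :
    𝕋.ext (relComp s r) = relComp (𝕋.ext s) (𝕋.ext r) := by
  have key : (fun p : X × Z => relComp s r p.1 p.2) =
      directImage (fun t : X × Y × Z => (t.1, t.2.2)) (fun t => r t.1 t.2.1 * s t.2.1 t.2.2) := by
    funext p
    apply le_antisymm
    · refine iSup_le fun y => ?_
      exact le_iSup₂ (f := fun (t : X × Y × Z) (_ : (t.1, t.2.2) = p) =>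
        r t.1 t.2.1 * s t.2.1 t.2.2) (p.1, y, p.2) rfl
    · refine iSup₂_le ?_
      rintro t rfl
      exact le_relComp (s := s) (r := r) t.2.1
  apply le_antisymm
  · refine 𝕋.ext_le fun w => ?_
    rw [key, ξ_map_directImage]
    refine iSup₂_le ?_
    rintro t rfl
    rw [ξ_map_mul (φ := fun t : X × Y × Z => r t.1 t.2.1) (ψ := fun t => s t.2.1 t.2.2)]
    have h1 := 𝕋.le_ext r (𝕋.map (fun t : X × Y × Z => (t.1, t.2.1)) t)
    have h2 := 𝕋.le_ext s (𝕋.map (fun t : X × Y × Z => (t.2.1, t.2.2)) t)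
    simp only [map_map] at h1 h2 ⊢
    exact (mul_le_mul' h1 h2).trans (le_relComp _)
  · intro 𝔵 𝔷
    refine iSup_le fun 𝔶 => ?_
    refine qSup_mul_le ?_
    rintro w ⟨rfl, rfl⟩
    refine mul_qSup_le ?_
    rintro v ⟨hv, rfl⟩
    obtain ⟨t, rfl, rfl⟩ := 𝕋.exists_of_weakPullback
      (p := fun t : X × Y × Z => (t.1, t.2.1)) (q := fun t : X × Y × Z => (t.2.1, t.2.2))
      (f := Prod.snd) (g := Prod.fst)
      ⟨rfl, by rintro ⟨x, y⟩ ⟨y', z⟩ (rfl : y = y'); exact ⟨(x, y, z), rfl, rfl⟩⟩ w v hv.symm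
    have h := 𝕋.le_ext (relComp s r) (𝕋.map (fun t : X × Y × Z => (t.1, t.2.2)) t)
    refine le_trans ?_ (h.trans_eq ?_)
    · simp only [map_map]
      rw [← ξ_map_mul (φ := fun t : X × Y × Z => r t.1 t.2.1) (ψ := fun t => s t.2.1 t.2.2)]
      exact 𝕋.ξ_map_mono (fun t : X × Y × Z => le_relComp (s := s) (r := r) t.2.1) t
    · simp only [map_map]

/-- `T_ξ` commutes with precomposition by functions in the first variable. -/
theorem ext_precomp {X Y Z : Type u} (s : Y → Z → V) (f : X → Y) (𝔵 : 𝕋.F X) (𝔷 : 𝕋.F Z) :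
    𝕋.ext (fun x z => s (f x) z) 𝔵 𝔷 = 𝕋.ext s (𝕋.map f 𝔵) 𝔷 := by
  apply le_antisymm
  · refine iSup₂_le ?_
    rintro w ⟨rfl, rfl⟩
    have h := 𝕋.le_ext s (𝕋.map (fun p : X × Z => (f p.1, p.2)) w)
    simp only [map_map] at h ⊢
    exact h
  · refine iSup₂_le ?_
    rintro w ⟨hw, rfl⟩
    obtain ⟨t, rfl, rfl⟩ := 𝕋.exists_of_weakPullback
      (p := fun p : X × Z => (f p.1, p.2)) (q := Prod.fst) (f := Prod.fst) (g := f)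
      ⟨rfl, by rintro ⟨y, z⟩ x (rfl : y = f x); exact ⟨(x, z), rfl, rfl⟩⟩ w 𝔵 hw
    have h := 𝕋.le_ext (fun x z => s (f x) z) t
    simp only [map_map] at h ⊢
    exact h

theorem ext_swap {X Y : Type u} (r : X → Y → V) (𝔵 : 𝕋.F X) (𝔶 : 𝕋.F Y) :
    𝕋.ext (fun y x => r x y) 𝔶 𝔵 = 𝕋.ext r 𝔵 𝔶 := by
  apply le_antisymm
  · refine iSup₂_le ?_
    rintro w ⟨rfl, rfl⟩
    have h := 𝕋.le_ext r (𝕋.map Prod.swap w)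
    simp only [map_map] at h ⊢
    exact h
  · refine iSup₂_le ?_
    rintro w ⟨rfl, rfl⟩
    have h := 𝕋.le_ext (fun y x => r x y) (𝕋.map Prod.swap w)
    simp only [map_map] at h ⊢
    exact h

theorem le_ext_e {X Y : Type u} (r : X → Y → V) (x : X) (y : Y) :
    r x y ≤ 𝕋.ext r (𝕋.e x) (𝕋.e y) := by
  have h := 𝕋.le_ext r (𝕋.e (x, y))
  rwa [ξ_map_e, map_e, map_e] at h

theorem one_le_ext_refl {X : Type u} {r : X → X → V} (h : ∀ x, 1 ≤ r x x) (𝔵 : 𝕋.F X) :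
    1 ≤ 𝕋.ext r 𝔵 𝔵 := by
  have h1 := 𝕋.le_ext r (𝕋.map (fun x => (x, x)) 𝔵)
  simp only [map_map, map_id] at h1
  refine le_trans ?_ h1
  rw [← 𝕋.ξ_map_one 𝔵]
  exact 𝕋.ξ_map_mono h 𝔵

theorem ξ_map_ext {X Y : Type u} (r : X → Y → V) (W : 𝕋.F (𝕋.F X × 𝕋.F Y)) :
    𝕋.ξ (𝕋.map (fun p => 𝕋.ext r p.1 p.2) W) =
      ⨆ (U : 𝕋.F (𝕋.F (X × Y)))
        (_ : 𝕋.map (fun w => (𝕋.map Prod.fst w, 𝕋.map Prod.snd w)) U = W),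
        𝕋.ξ (𝕋.map (fun p => r p.1 p.2) (𝕋.m U)) := by
  have key : (fun p : 𝕋.F X × 𝕋.F Y => 𝕋.ext r p.1 p.2) =
      directImage (fun w => (𝕋.map Prod.fst w, 𝕋.map Prod.snd w))
        (fun w => 𝕋.ξ (𝕋.map (fun p : X × Y => r p.1 p.2) w)) := by
    funext p
    simp only [ext, directImage, Prod.ext_iff]
  rw [key, ξ_map_directImage]
  simp only [ξ_map_ξ]

theorem ext_ext_le {X Y : Type u} (r : X → Y → V) (𝔛 : 𝕋.F (𝕋.F X)) (𝔜 : 𝕋.F (𝕋.F Y)) :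
    𝕋.ext (𝕋.ext r) 𝔛 𝔜 ≤ 𝕋.ext r (𝕋.m 𝔛) (𝕋.m 𝔜) := by
  refine 𝕋.ext_le (s := fun 𝔛 𝔜 => 𝕋.ext r (𝕋.m 𝔛) (𝕋.m 𝔜)) (fun W => ?_) 𝔛 𝔜
  rw [ξ_map_ext]
  refine iSup₂_le ?_
  rintro U rfl
  refine (𝕋.le_ext r _).trans_eq ?_
  simp only [map_map, map_m]

theorem ext_m_le {X Y : Type u} (r : X → Y → V) (𝔛 : 𝕋.F (𝕋.F X)) (𝔶 : 𝕋.F Y) :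
    𝕋.ext r (𝕋.m 𝔛) 𝔶 ≤ ⨆ (𝔜 : 𝕋.F (𝕋.F Y)) (_ : 𝕋.m 𝔜 = 𝔶), 𝕋.ext (𝕋.ext r) 𝔛 𝔜 := by
  refine iSup₂_le ?_
  rintro w ⟨hw, rfl⟩
  obtain ⟨U, rfl, hU⟩ := (𝕋.mu_weakPullback (Prod.fst : X × Y → X)).2 w 𝔛 hw
  change 𝕋.map (𝕋.map Prod.fst) U = 𝔛 at hU
  change 𝕋.ξ (𝕋.map _ (𝕋.m U)) ≤ ⨆ (𝔜) (_ : 𝕋.m 𝔜 = 𝕋.map Prod.snd (𝕋.m U)), _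
  refine le_trans ?_ (le_iSup₂ (f := fun (𝔜 : 𝕋.F (𝕋.F Y))
    (_ : 𝕋.m 𝔜 = 𝕋.map Prod.snd (𝕋.m U)) => 𝕋.ext (𝕋.ext r) 𝔛 𝔜)
    (𝕋.map (𝕋.map Prod.snd) U) (𝕋.map_m _ _).symm)
  have h := 𝕋.le_ext (𝕋.ext r) (𝕋.map (fun w => (𝕋.map Prod.fst w, 𝕋.map Prod.snd w)) U)
  simp only [map_map] at h
  change _ ≤ 𝕋.ext (𝕋.ext r) (𝕋.map (𝕋.map Prod.fst) U) (𝕋.map (𝕋.map Prod.snd) U) at h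
  rw [hU] at h
  refine le_trans ?_ h
  have h2 := 𝕋.ξ_map_ext r (𝕋.map (fun w => (𝕋.map Prod.fst w, 𝕋.map Prod.snd w)) U)
  simp only [map_map] at h2
  rw [h2]
  exact le_iSup₂ (f := fun (U' : 𝕋.F (𝕋.F (X × Y)))
    (_ : 𝕋.map (fun w => (𝕋.map Prod.fst w, 𝕋.map Prod.snd w)) U' =
      𝕋.map (fun w => (𝕋.map Prod.fst w, 𝕋.map Prod.snd w)) U) =>
        𝕋.ξ (𝕋.map (fun p : X × Y => r p.1 p.2) (𝕋.m U'))) U rfl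

theorem relComp_ext_ext_le {A X Y Z : Type u} {χ : 𝕋.F Y → Z → V} {ψ : 𝕋.F X → Y → V}
    {ρ : 𝕋.F X → Z → V} (h : ∀ 𝔛 z, relComp χ (𝕋.ext ψ) 𝔛 z ≤ ρ (𝕋.m 𝔛) z) (s : A → X → V)
    (𝔄 : 𝕋.F (𝕋.F A)) (z : Z) :
    relComp χ (𝕋.ext (relComp ψ (𝕋.ext s))) 𝔄 z ≤ relComp ρ (𝕋.ext s) (𝕋.m 𝔄) z := by
  rw [ext_comp, relComp_assoc]
  refine iSup_le fun 𝔛 => ?_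
  exact (mul_le_mul' (𝕋.ext_ext_le s 𝔄 𝔛) (h 𝔛 z)).trans (le_relComp _)

theorem le_relComp_ext_ext {A X Y Z : Type u} {χ : 𝕋.F Y → Z → V} {ψ : 𝕋.F X → Y → V}
    {ρ : 𝕋.F X → Z → V} (h : ∀ 𝔛 z, ρ (𝕋.m 𝔛) z ≤ relComp χ (𝕋.ext ψ) 𝔛 z) (s : A → X → V)
    (𝔄 : 𝕋.F (𝕋.F A)) (z : Z) :
    relComp ρ (𝕋.ext s) (𝕋.m 𝔄) z ≤ relComp χ (𝕋.ext (relComp ψ (𝕋.ext s))) 𝔄 z := by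
  rw [ext_comp, relComp_assoc]
  refine iSup_le fun 𝔵 => ?_
  refine (mul_le_mul_left (𝕋.ext_m_le s 𝔄 𝔵) (ρ 𝔵 z)).trans ?_
  refine qSup_mul_le ?_
  rintro 𝔛 rfl
  exact (mul_le_mul_right (h 𝔛 z) (𝕋.ext (𝕋.ext s) 𝔄 𝔛)).trans (le_relComp _)

/-- If `T1 = 1`, then `T_ξ r (e x, -) = ξ · T (r (x, -))`. -/
theorem ext_e [Subsingleton (𝕋.F PUnit.{u + 1})] {X Y : Type u} (r : X → Y → V) (x : X)
    (𝔶 : 𝕋.F Y) : 𝕋.ext r (𝕋.e x) 𝔶 = 𝕋.ξ (𝕋.map (r x) 𝔶) := by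
  have hconst : ∀ {A : Type u} (w : 𝕋.F A), 𝕋.map (fun _ => x) w = 𝕋.e x := by
    intro A w
    have h1 : 𝕋.map (fun _ : A => PUnit.unit.{u + 1}) w = 𝕋.e PUnit.unit :=
      Subsingleton.elim _ _
    have h2 := congrArg (𝕋.map (fun _ : PUnit.{u + 1} => x)) h1
    rwa [map_map, map_e] at h2
  apply le_antisymm
  · have h := 𝕋.ext_precomp r (fun _ : PUnit.{u + 1} => x) (𝕋.e PUnit.unit) 𝔶
    rw [map_e] at h
    rw [← h]
    refine iSup₂_le ?_
    rintro w ⟨-, rfl⟩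
    rw [map_map]
  · have h := 𝕋.le_ext r (𝕋.map (fun y => (x, y)) 𝔶)
    simp only [map_map, map_id, hconst] at h
    exact h

/-! ## `𝕋`-categories and `𝕋`-functors -/

/-- The underlying `V`-relation `a₀ = a · e` of a `𝕋`-relation `a`. -/
def under {X Y : Type u} (a : 𝕋.F X → Y → V) : X → Y → V := fun x y => a (𝕋.e x) y

/-- `f` is a `𝕋`-functor (a morphism of `𝕋`-graphs) from `(X, a)` to `(Y, b)`. -/
def IsTFunctor {X Y : Type u} (a : 𝕋.F X → X → V) (b : 𝕋.F Y → Y → V) (f : X → Y) : Prop :=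
  ∀ 𝔵 x, a 𝔵 x ≤ b (𝕋.map f 𝔵) (f x)

/-- A `𝕋`-category. -/
structure TCat where
  carrier : Type u
  str : 𝕋.F carrier → carrier → V
  refl : ∀ x, 1 ≤ str (𝕋.e x) x
  trans : ∀ 𝔛 𝔵 x, 𝕋.ext str 𝔛 𝔵 * str 𝔵 x ≤ str (𝕋.m 𝔛) x

variable {𝕋}

namespace TCat

variable (X : TCat 𝕋)

/-- The structure `a₀` of the underlying `V`-category. -/
abbrev str₀ : X.carrier → X.carrier → V := 𝕋.under X.str

theorem comp_le (𝔛 : 𝕋.F (𝕋.F X.carrier)) (x : X.carrier) :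
    relComp X.str (𝕋.ext X.str) 𝔛 x ≤ X.str (𝕋.m 𝔛) x :=
  iSup_le fun 𝔵 => X.trans 𝔛 𝔵 x

theorem str_mul_str₀ (𝔵 : 𝕋.F X.carrier) (x y : X.carrier) :
    X.str 𝔵 x * X.str₀ x y ≤ X.str 𝔵 y := by
  have h := X.trans (𝕋.e 𝔵) (𝕋.e x) y
  rw [m_e] at h
  exact (mul_le_mul_left (𝕋.le_ext_e X.str 𝔵 x) _).trans h

theorem ext_str₀_mul_str (𝔵 𝔶 : 𝕋.F X.carrier) (y : X.carrier) :
    𝕋.ext X.str₀ 𝔵 𝔶 * X.str 𝔶 y ≤ X.str 𝔵 y := by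
  have h := X.trans (𝕋.map 𝕋.e 𝔵) 𝔶 y
  rw [m_map_e, ← ext_precomp] at h
  exact h

theorem relComp_str₀_str : relComp X.str₀ X.str = X.str := by
  apply le_antisymm
  · exact fun 𝔵 y => iSup_le fun x => X.str_mul_str₀ 𝔵 x y
  · intro 𝔵 y
    refine le_trans ?_ (le_relComp y)
    exact le_mul_of_one_le_right' (X.refl y)

theorem relComp_str_ext_str₀ : relComp X.str (𝕋.ext X.str₀) = X.str := by
  apply le_antisymm
  · exact fun 𝔵 y => iSup_le fun 𝔶 => X.ext_str₀_mul_str 𝔵 𝔶 y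
  · intro 𝔵 y
    refine le_trans ?_ (le_relComp 𝔵)
    exact le_mul_of_one_le_left' (𝕋.one_le_ext_refl X.refl 𝔵)

theorem str₀_trans (x y z : X.carrier) : X.str₀ x y * X.str₀ y z ≤ X.str₀ x z :=
  X.str_mul_str₀ (𝕋.e x) y z

theorem relComp_str₀_str₀ : relComp X.str₀ X.str₀ = X.str₀ := by
  funext x y
  exact congrFun (congrFun X.relComp_str₀_str (𝕋.e x)) y

end TCat

variable (𝕋) in
/-- The `𝕋`-relation `T_ξ a · m° · m` on `TX`. -/
def freeStr {X : Type u} (a : 𝕋.F X → X → V) : 𝕋.F (𝕋.F X) → 𝕋.F X → V :=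
  fun 𝔛 𝔵 => ⨆ (𝔜 : 𝕋.F (𝕋.F X)) (_ : 𝕋.m 𝔜 = 𝕋.m 𝔛), 𝕋.ext a 𝔜 𝔵

theorem le_freeStr {X : Type u} (a : 𝕋.F X → X → V) {𝔛 𝔜 : 𝕋.F (𝕋.F X)} (h : 𝕋.m 𝔜 = 𝕋.m 𝔛)
    (𝔵 : 𝕋.F X) : 𝕋.ext a 𝔜 𝔵 ≤ 𝕋.freeStr a 𝔛 𝔵 :=
  le_iSup₂ (f := fun (𝔜 : 𝕋.F (𝕋.F X)) (_ : 𝕋.m 𝔜 = 𝕋.m 𝔛) => 𝕋.ext a 𝔜 𝔵) 𝔜 h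

theorem ext_freeStr_le {X : Type u} (a : 𝕋.F X → X → V) (𝔐 : 𝕋.F (𝕋.F (𝕋.F X)))
    (𝔛 : 𝕋.F (𝕋.F X)) : 𝕋.ext (𝕋.freeStr a) 𝔐 𝔛 ≤
      ⨆ (𝔑 : 𝕋.F (𝕋.F (𝕋.F X))) (_ : 𝕋.map 𝕋.m 𝔑 = 𝕋.map 𝕋.m 𝔐), 𝕋.ext (𝕋.ext a) 𝔑 𝔛 := by
  let r : 𝕋.F X → 𝕋.F X → V := fun 𝔶 𝔵 => ⨆ (𝔜 : 𝕋.F (𝕋.F X)) (_ : 𝕋.m 𝔜 = 𝔶), 𝕋.ext a 𝔜 𝔵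
  have h0 : 𝕋.freeStr a = fun 𝔛 𝔵 => r (𝕋.m 𝔛) 𝔵 := rfl
  rw [h0, ext_precomp]
  have key : (fun p : 𝕋.F X × 𝕋.F X => r p.1 p.2) =
      directImage (fun q : 𝕋.F (𝕋.F X) × 𝕋.F X => (𝕋.m q.1, q.2)) (fun q => 𝕋.ext a q.1 q.2) := by
    funext p
    apply le_antisymm
    · refine iSup₂_le fun 𝔜 h𝔜 => ?_
      exact le_iSup₂ (f := fun (q : 𝕋.F (𝕋.F X) × 𝕋.F X) (_ : (𝕋.m q.1, q.2) = p) =>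
        𝕋.ext a q.1 q.2) (𝔜, p.2) (Prod.ext h𝔜 rfl)
    · refine iSup₂_le ?_
      rintro q rfl
      exact le_iSup₂ (f := fun (𝔜 : 𝕋.F (𝕋.F X)) (_ : 𝕋.m 𝔜 = 𝕋.m q.1) => 𝕋.ext a 𝔜 q.2) q.1 rfl
  refine iSup₂_le ?_
  rintro w ⟨hw, rfl⟩
  rw [key, ξ_map_directImage]
  refine iSup₂_le ?_
  rintro v rfl
  have h1 := 𝕋.le_ext (𝕋.ext a) v
  simp only [map_map] at hw ⊢
  refine h1.trans (le_iSup₂ (f := fun (𝔑 : 𝕋.F (𝕋.F (𝕋.F X)))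
    (_ : 𝕋.map 𝕋.m 𝔑 = 𝕋.map 𝕋.m 𝔐) => 𝕋.ext (𝕋.ext a) 𝔑 (𝕋.map Prod.snd v))
      (𝕋.map Prod.fst v) ?_)
  rw [← hw, map_map]

/-- The `𝕋`-category `TX = (TX, T_ξ a · m° · m)`. -/
@[reducible]
def TCat.free (X : TCat 𝕋) : TCat 𝕋 where
  carrier := 𝕋.F X.carrier
  str := 𝕋.freeStr X.str
  refl 𝔵 := by
    refine le_trans ?_ (le_freeStr X.str (𝔜 := 𝕋.map 𝕋.e 𝔵) ((𝕋.m_map_e 𝔵).trans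
      (𝕋.m_e 𝔵).symm) 𝔵)
    rw [← ext_precomp]
    exact 𝕋.one_le_ext_refl X.refl 𝔵
  trans 𝔐 𝔛 𝔵 := by
    refine (mul_le_mul_left (ext_freeStr_le X.str 𝔐 𝔛) _).trans ?_
    refine qSup_mul_le fun 𝔑 h𝔑 => ?_
    refine mul_qSup_le fun 𝔜 h𝔜 => ?_
    have h1 : 𝕋.ext (𝕋.ext X.str) 𝔑 𝔛 ≤ 𝕋.ext X.str (𝕋.m 𝔑) (𝕋.m 𝔜) := by
      rw [h𝔜]
      exact 𝕋.ext_ext_le _ _ _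
    have h2 : 𝕋.ext X.str (𝕋.m 𝔑) (𝕋.m 𝔜) ≤
        ⨆ (𝔓 : 𝕋.F (𝕋.F (𝕋.F X.carrier))) (_ : 𝕋.m 𝔓 = 𝕋.m 𝔑),
          𝕋.ext (𝕋.ext X.str) 𝔓 𝔜 := by
      rw [← ext_swap]
      refine (𝕋.ext_m_le _ _ _).trans (iSup₂_mono fun 𝔓 _ => ?_)
      rw [← ext_swap (r := 𝕋.ext X.str)]
      refine 𝕋.ext_mono (fun y x => ?_) _ _
      rw [ext_swap]
    refine (mul_le_mul_left (h1.trans h2) _).trans ?_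
    refine qSup_mul_le fun 𝔓 h𝔓 => ?_
    have h3 : 𝕋.ext (𝕋.ext X.str) 𝔓 𝔜 * 𝕋.ext X.str 𝔜 𝔵 ≤
        relComp (𝕋.ext X.str) (𝕋.ext (𝕋.ext X.str)) 𝔓 𝔵 := le_relComp _
    rw [← ext_comp] at h3
    have h4 := h3.trans (𝕋.ext_mono (s := fun 𝔛 x => X.str (𝕋.m 𝔛) x) X.comp_le 𝔓 𝔵)
    rw [ext_precomp (s := X.str) (f := 𝕋.m)] at h4
    refine h4.trans (le_freeStr X.str ?_ 𝔵)
    rw [m_map_m, h𝔓, ← m_map_m, h𝔑, m_map_m]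

/-- The order between functions into a `𝕋`-category, evaluated at a point: `1 ≤ a₀(x, y)`. -/
def TCat.Le (X : TCat 𝕋) (x y : X.carrier) : Prop := 1 ≤ X.str₀ x y

/-- Points are equivalent if they are below each other. -/
def TCat.Equivalent (X : TCat 𝕋) (x y : X.carrier) : Prop := X.Le x y ∧ X.Le y x

theorem TCat.Le.trans {X : TCat 𝕋} {x y z : X.carrier} (h : X.Le x y) (h' : X.Le y z) :
    X.Le x z := by
  have := mul_le_mul' h h'
  rw [one_mul] at this
  exact this.trans (X.str₀_trans x y z)

theorem IsTFunctor.le {X Y : TCat 𝕋} {f : X.carrier → Y.carrier}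
    (hf : 𝕋.IsTFunctor X.str Y.str f) (x y : X.carrier) : X.str₀ x y ≤ Y.str₀ (f x) (f y) := by
  have h := hf (𝕋.e x) y
  rwa [map_e] at h

theorem IsTFunctor.map_le {X Y : TCat 𝕋} {f : X.carrier → Y.carrier}
    (hf : 𝕋.IsTFunctor X.str Y.str f) {x y : X.carrier} (h : X.Le x y) : Y.Le (f x) (f y) :=
  LE.le.trans h (hf.le x y)

theorem IsTFunctor.comp {X Y Z : Type u} {a : 𝕋.F X → X → V} {b : 𝕋.F Y → Y → V}
    {c : 𝕋.F Z → Z → V} {g : Y → Z} {f : X → Y} (hg : 𝕋.IsTFunctor b c g)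
    (hf : 𝕋.IsTFunctor a b f) : 𝕋.IsTFunctor a c (fun x => g (f x)) := fun 𝔵 x => by
  have h := (hf 𝔵 x).trans (hg _ _)
  rwa [map_map] at h

/-! ## Representable `𝕋`-categories and pseudo-homomorphisms -/

/-- `α : TX → X` is left adjoint to `e : X → TX` in the `2`-category of `𝕋`-categories. -/
structure TCat.IsLeftAdjointUnit (X : TCat 𝕋) (α : 𝕋.F X.carrier → X.carrier) : Prop where
  isTFunctor : 𝕋.IsTFunctor X.free.str X.str α
  unit : ∀ 𝔵, X.free.Le 𝔵 (𝕋.e (α 𝔵))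
  counit : ∀ x, X.Le (α (𝕋.e x)) x

/-- `X` is representable if `e : X → TX` has a left adjoint. -/
def TCat.IsRepresentable (X : TCat 𝕋) : Prop :=
  ∃ α : 𝕋.F X.carrier → X.carrier, X.IsLeftAdjointUnit α

namespace TCat.IsLeftAdjointUnit

variable {X : TCat 𝕋} {α : 𝕋.F X.carrier → X.carrier}

theorem one_le_str (hα : X.IsLeftAdjointUnit α) (𝔵 : 𝕋.F X.carrier) : 1 ≤ X.str 𝔵 (α 𝔵) := by
  refine LE.le.trans (hα.unit 𝔵) (iSup₂_le fun 𝔜 h𝔜 => ?_)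
  have h := X.trans 𝔜 (𝕋.e (α 𝔵)) (α 𝔵)
  rw [h𝔜.trans (𝕋.m_e 𝔵)] at h
  exact (le_mul_of_one_le_right' (X.refl _)).trans h

theorem str_m_le (hα : X.IsLeftAdjointUnit α) (𝔛 : 𝕋.F (𝕋.F X.carrier)) (x : X.carrier) :
    X.str (𝕋.m 𝔛) x ≤ X.str (𝕋.map α 𝔛) x := by
  have h1 : X.str (𝕋.m 𝔛) x ≤ X.str (𝕋.map α 𝔛) (α (𝕋.e x)) :=
    ((𝕋.le_ext_e X.str (𝕋.m 𝔛) x).trans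
      (le_freeStr X.str (𝔛 := 𝔛) (𝕋.m_e _) (𝕋.e x))).trans (hα.isTFunctor 𝔛 (𝕋.e x))
  have h2 := X.str_mul_str₀ (𝕋.map α 𝔛) (α (𝕋.e x)) x
  exact (h1.trans (le_mul_of_one_le_right' (hα.counit x))).trans h2

/-- A representable structure has the form `a = a₀ · α`. -/
theorem str_eq (hα : X.IsLeftAdjointUnit α) (𝔵 : 𝕋.F X.carrier) (x : X.carrier) :
    X.str 𝔵 x = X.str₀ (α 𝔵) x := by
  apply le_antisymm
  · have h := hα.str_m_le (𝕋.e 𝔵) x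
    rwa [m_e, map_e] at h
  · exact (le_mul_of_one_le_left' (hα.one_le_str 𝔵)).trans (X.str_mul_str₀ 𝔵 (α 𝔵) x)

/-- Representable `𝕋`-categories are core-compact. -/
theorem le_comp (hα : X.IsLeftAdjointUnit α) (𝔛 : 𝕋.F (𝕋.F X.carrier)) (x : X.carrier) :
    X.str (𝕋.m 𝔛) x ≤ relComp X.str (𝕋.ext X.str) 𝔛 x := by
  refine ((hα.str_m_le 𝔛 x).trans (le_mul_of_one_le_left' ?_)).trans (le_relComp (𝕋.map α 𝔛))
  have h := 𝕋.le_ext X.str (𝕋.map (fun 𝔵 => (𝔵, α 𝔵)) 𝔛)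
  simp only [map_map, map_id] at h
  refine le_trans ?_ h
  rw [← 𝕋.ξ_map_one 𝔛]
  exact 𝕋.ξ_map_mono (fun 𝔵 => hα.one_le_str 𝔵) 𝔛

theorem le_of_isLeftAdjointUnit (hα : X.IsLeftAdjointUnit α) {β : 𝕋.F X.carrier → X.carrier}
    (hβ : X.IsLeftAdjointUnit β) (𝔵 : 𝕋.F X.carrier) : X.Le (α 𝔵) (β 𝔵) := by
  unfold TCat.Le
  rw [← hα.str_eq]
  exact hβ.one_le_str 𝔵

end TCat.IsLeftAdjointUnit

/-- `f` is a pseudo-homomorphism: a `𝕋`-functor with `β · Tf ≃ f · α` for the left adjoints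
`α`, `β` of the units (which are unique up to equivalence). -/
structure IsPseudoHom (X Y : TCat 𝕋) (f : X.carrier → Y.carrier) : Prop where
  isTFunctor : 𝕋.IsTFunctor X.str Y.str f
  equivalent : ∀ α β, X.IsLeftAdjointUnit α → Y.IsLeftAdjointUnit β →
    ∀ 𝔵, Y.Equivalent (β (𝕋.map f 𝔵)) (f (α 𝔵))

/-- It suffices to check the condition for one choice of left adjoints. -/
theorem IsPseudoHom.of_eq {X Y : TCat 𝕋} {f : X.carrier → Y.carrier}
    (hf : 𝕋.IsTFunctor X.str Y.str f) {α : 𝕋.F X.carrier → X.carrier}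
    {β : 𝕋.F Y.carrier → Y.carrier} (hα : X.IsLeftAdjointUnit α) (hβ : Y.IsLeftAdjointUnit β)
    (h : ∀ 𝔵, Y.Equivalent (β (𝕋.map f 𝔵)) (f (α 𝔵))) : IsPseudoHom X Y f where
  isTFunctor := hf
  equivalent _ _ hα' hβ' 𝔵 :=
    ⟨((hβ'.le_of_isLeftAdjointUnit hβ _).trans (h 𝔵).1).trans
      (hf.map_le (hα.le_of_isLeftAdjointUnit hα' 𝔵)),
    (hf.map_le (hα'.le_of_isLeftAdjointUnit hα 𝔵)).trans
      ((h 𝔵).2.trans (hβ.le_of_isLeftAdjointUnit hβ' _))⟩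

theorem IsPseudoHom.id (X : TCat 𝕋) : IsPseudoHom X X (fun x => x) where
  isTFunctor 𝔵 x := by rw [map_id]
  equivalent α β hα hβ 𝔵 := by
    rw [map_id]
    exact ⟨hβ.le_of_isLeftAdjointUnit hα 𝔵, hα.le_of_isLeftAdjointUnit hβ 𝔵⟩

theorem IsPseudoHom.comp {X Y Z : TCat 𝕋} {g : Y.carrier → Z.carrier} {f : X.carrier → Y.carrier}
    (hY : Y.IsRepresentable) (hg : IsPseudoHom Y Z g) (hf : IsPseudoHom X Y f) :
    IsPseudoHom X Z (fun x => g (f x)) where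
  isTFunctor := hg.isTFunctor.comp hf.isTFunctor
  equivalent α γ hα hγ 𝔵 := by
    obtain ⟨β, hβ⟩ := hY
    have h1 := hg.equivalent β γ hβ hγ (𝕋.map f 𝔵)
    have h2 := hf.equivalent α β hα hβ 𝔵
    rw [map_map] at h1
    exact ⟨h1.1.trans (hg.isTFunctor.map_le h2.1), (hg.isTFunctor.map_le h2.2).trans h1.2⟩

variable (𝕋) in
/-- Objects of the category `Repr(𝕋)`: representable `𝕋`-categories. -/
structure Repr extends TCat 𝕋 where
  isRepresentable : toTCat.IsRepresentable

/-- Morphisms of `Repr(𝕋)`: pseudo-homomorphisms. -/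
@[ext]
structure Repr.Hom (X Y : Repr 𝕋) where
  toFun : X.carrier → Y.carrier
  isPseudoHom : IsPseudoHom X.toTCat Y.toTCat toFun

instance : Category (Repr 𝕋) where
  Hom := Repr.Hom
  id X := ⟨fun x => x, IsPseudoHom.id X.toTCat⟩
  comp {_ Y _} f g := ⟨fun x => g.toFun (f.toFun x), g.isPseudoHom.comp Y.isRepresentable
    f.isPseudoHom⟩

/-! ## The category `ReprDist(𝕋)` -/

/-- `ψ` is a `V`-distributor `X₀ ⇸ Y₀` with `ψ · a = b · T_ξ ψ`. -/
structure IsReprDist (X Y : TCat 𝕋) (ψ : X.carrier → Y.carrier → V) : Prop where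
  isVDistributor : IsVDistributor X.str₀ Y.str₀ ψ
  comm : relComp ψ X.str = relComp Y.str (𝕋.ext ψ)

theorem IsReprDist.id (X : TCat 𝕋) : IsReprDist X X X.str₀ where
  isVDistributor := ⟨X.relComp_str₀_str₀.le, X.relComp_str₀_str₀.le⟩
  comm := X.relComp_str₀_str.trans X.relComp_str_ext_str₀.symm

theorem IsReprDist.relComp_str₀ {X Y : TCat 𝕋} {ψ : X.carrier → Y.carrier → V}
    (h : IsReprDist X Y ψ) : relComp ψ X.str₀ = ψ :=
  le_antisymm h.isVDistributor.1 fun x _ =>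
    (le_mul_of_one_le_left' (X.refl x)).trans (le_relComp (s := ψ) (r := X.str₀) x)

theorem IsReprDist.str₀_relComp {X Y : TCat 𝕋} {ψ : X.carrier → Y.carrier → V}
    (h : IsReprDist X Y ψ) : relComp Y.str₀ ψ = ψ :=
  le_antisymm h.isVDistributor.2 fun _ y =>
    (le_mul_of_one_le_right' (Y.refl y)).trans (le_relComp (s := Y.str₀) (r := ψ) y)

theorem IsReprDist.comp {X Y Z : TCat 𝕋} {χ : Y.carrier → Z.carrier → V}
    {ψ : X.carrier → Y.carrier → V} (hχ : IsReprDist Y Z χ) (hψ : IsReprDist X Y ψ) :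
    IsReprDist X Z (relComp χ ψ) where
  isVDistributor := by
    constructor
    · rw [← relComp_assoc, hψ.relComp_str₀]
    · rw [relComp_assoc, hχ.str₀_relComp]
  comm := by
    rw [ext_comp, ← relComp_assoc, hψ.comm, relComp_assoc, hχ.comm, relComp_assoc]

variable (𝕋) in
/-- Objects of the category `ReprDist(𝕋)`: representable `𝕋`-categories. -/
structure ReprDist where
  of : Repr 𝕋

/-- Morphisms of `ReprDist(𝕋)`. -/
@[ext]
structure ReprDist.Hom (X Y : ReprDist 𝕋) where
  rel : X.of.carrier → Y.of.carrier → V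
  isReprDist : IsReprDist X.of.toTCat Y.of.toTCat rel

instance : Category (ReprDist 𝕋) where
  Hom := ReprDist.Hom
  id X := ⟨X.of.str₀, IsReprDist.id X.of.toTCat⟩
  comp ψ χ := ⟨relComp χ.rel ψ.rel, χ.isReprDist.comp ψ.isReprDist⟩
  id_comp ψ := ReprDist.Hom.ext ψ.isReprDist.relComp_str₀
  comp_id ψ := ReprDist.Hom.ext ψ.isReprDist.str₀_relComp
  assoc ψ χ ω := ReprDist.Hom.ext (relComp_assoc ω.rel χ.rel ψ.rel)

/-! ## Kleisli convolution -/

variable (𝕋) in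
/-- The Kleisli convolution `β ∘ α = β · T_ξ α · m°` of `𝕋`-relations. -/
def kconv {X Y Z : Type u} (β : 𝕋.F Y → Z → V) (α : 𝕋.F X → Y → V) : 𝕋.F X → Z → V :=
  fun 𝔵 z => ⨆ (𝔛 : 𝕋.F (𝕋.F X)) (_ : 𝕋.m 𝔛 = 𝔵), relComp β (𝕋.ext α) 𝔛 z

/-- The `𝕋`-relation `f_⊛ = b · Tf`. -/
def lowerStar {X : Type u} (Y : TCat 𝕋) (f : X → Y.carrier) : 𝕋.F X → Y.carrier → V :=
  fun 𝔵 y => Y.str (𝕋.map f 𝔵) y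

/-- The `𝕋`-relation `f^⊛ = f° · b`. -/
def upperStar {X : Type u} (Y : TCat 𝕋) (f : X → Y.carrier) : 𝕋.F Y.carrier → X → V :=
  fun 𝔶 x => Y.str 𝔶 (f x)

variable (𝕋) in
/-- The Kleisli convolution `ψ ∘ φ` of a `𝕋`-relation `ψ` from `X` to `Y` with a `V`-valued function
`φ` on `X`, the latter being considered as a `𝕋`-relation from `1` to `X`. -/
def act {X Y : Type u} (ψ : 𝕋.F X → Y → V) (φ : X → V) : Y → V :=
  fun y => 𝕋.kconv ψ (fun (_ : 𝕋.F PUnit.{u + 1}) x => φ x) (𝕋.e PUnit.unit) y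

/-! ## The Vietoris construction -/

variable (𝕋) in
/-- The `𝕋`-relation `hom_ξ` on `V`. -/
def homξ : 𝕋.F V → V → V := fun 𝔳 v => ihom (𝕋.ξ 𝔳) v

/-- The underlying set of the exponential `V^X`: the `𝕋`-functors from `X` to `(V, hom_ξ)`. (This is
used for theories with `T1 = 1`, where `G ⊗ X = X` for the generator `G = (1, e°)`.) -/
abbrev Pow (X : TCat 𝕋) : Type u := {φ : X.carrier → V // 𝕋.IsTFunctor X.str 𝕋.homξ φ}

/-- The evaluation, as a `V`-relation. -/
def ev (X : TCat 𝕋) : Pow X → X.carrier → V := fun φ x => φ.1 x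

/-- The `𝕋`-graph structure of the exponential `V^X`. -/
def powStr (X : TCat 𝕋) : 𝕋.F (Pow X) → Pow X → V := fun 𝔭 h =>
  ⨅ (𝔮 : 𝕋.F (Pow X × X.carrier)) (x : X.carrier) (_ : 𝕋.map Prod.fst 𝔮 = 𝔭),
    ihom (X.str (𝕋.map Prod.snd 𝔮) x) (𝕋.homξ (𝕋.map (fun p => ev X p.1 p.2) 𝔮) (h.1 x))

/-- The `V`-relation `μ = a · T_ξ ev`. -/
def mu (X : TCat 𝕋) : 𝕋.F (Pow X) → X.carrier → V := relComp X.str (𝕋.ext (ev X))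

/-- The structure of `VX`, the dual of `V^X`. -/
def vStr (X : TCat 𝕋) : 𝕋.F (Pow X) → Pow X → V := fun 𝔭 φ => ⨅ x, ihom (φ.1 x) (mu X 𝔭 x)

theorem Pow.ext {X : TCat 𝕋} {φ ψ : Pow X} (h : ∀ x, φ.1 x = ψ.1 x) : φ = ψ :=
  Subtype.ext (funext h)

theorem isTFunctor_homξ_iff {X : TCat 𝕋} {φ : X.carrier → V} :
    𝕋.IsTFunctor X.str 𝕋.homξ φ ↔ ∀ 𝔵 x, X.str 𝔵 x * 𝕋.ξ (𝕋.map φ 𝔵) ≤ φ x :=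
  forall₂_congr fun _ _ => le_ihom

theorem Pow.mul_le {X : TCat 𝕋} (φ : Pow X) (𝔵 : 𝕋.F X.carrier) (x : X.carrier) :
    X.str 𝔵 x * 𝕋.ξ (𝕋.map φ.1 𝔵) ≤ φ.1 x := isTFunctor_homξ_iff.1 φ.2 𝔵 x

theorem Pow.str₀_mul_le {X : TCat 𝕋} (φ : Pow X) (x y : X.carrier) :
    X.str₀ x y * φ.1 x ≤ φ.1 y := by
  have h := φ.mul_le (𝕋.e x) y
  rwa [ξ_map_e] at h

theorem le_vStr {X : TCat 𝕋} {𝔭 : 𝕋.F (Pow X)} {φ : Pow X} {v : V} :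
    v ≤ vStr X 𝔭 φ ↔ ∀ x, v * φ.1 x ≤ mu X 𝔭 x :=
  le_iInf_iff.trans (forall_congr' fun _ => le_ihom)

theorem vStr_mul_le (X : TCat 𝕋) (𝔭 : 𝕋.F (Pow X)) (φ : Pow X) (x : X.carrier) :
    vStr X 𝔭 φ * φ.1 x ≤ mu X 𝔭 x := le_vStr.1 le_rfl x

theorem relComp_mu_le (X : TCat 𝕋) (𝔓 : 𝕋.F (𝕋.F (Pow X))) (x : X.carrier) :
    relComp X.str (𝕋.ext (mu X)) 𝔓 x ≤ mu X (𝕋.m 𝔓) x :=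
  𝕋.relComp_ext_ext_le X.comp_le (ev X) 𝔓 x

theorem mu_relComp_le (X : TCat 𝕋) (𝔓 : 𝕋.F (𝕋.F (Pow X))) (x : X.carrier) :
    relComp (mu X) (𝕋.ext (vStr X)) 𝔓 x ≤ mu X (𝕋.m 𝔓) x := by
  refine le_trans ?_ (relComp_mu_le X 𝔓 x)
  have h1 : relComp (ev X) (vStr X) ≤ mu X :=
    fun 𝔭 x => iSup_le fun φ => vStr_mul_le X 𝔭 φ x
  have h2 : relComp (mu X) (𝕋.ext (vStr X)) =
      relComp X.str (𝕋.ext (relComp (ev X) (vStr X))) := by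
    rw [ext_comp, relComp_assoc]
    rfl
  rw [h2]
  exact relComp_mono le_rfl (𝕋.ext_mono h1) 𝔓 x

/-- The `𝕋`-category `VX`. -/
@[reducible]
def TCat.vietoris (X : TCat 𝕋) : TCat 𝕋 where
  carrier := Pow X
  str := vStr X
  refl φ := le_vStr.2 fun x => by
    rw [one_mul]
    refine le_trans ?_ (le_relComp (𝕋.e x))
    exact (𝕋.le_ext_e (ev X) φ x).trans (le_mul_of_one_le_right' (X.refl x))
  trans 𝔓 𝔭 φ := le_vStr.2 fun x => by
    rw [mul_assoc]
    exact (mul_le_mul_right (vStr_mul_le X 𝔭 φ x) _).trans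
      ((le_relComp 𝔭).trans (mu_relComp_le X 𝔓 x))

theorem powStr_eq (X : TCat 𝕋) (𝔭 : 𝕋.F (Pow X)) (h : Pow X) :
    powStr X 𝔭 h = ⨅ x, ihom (mu X 𝔭 x) (h.1 x) := by
  apply le_antisymm
  · refine le_iInf fun x => le_ihom.2 ?_
    rw [mu, relComp, mul_comm]
    refine le_ihom.1 (iSup_le fun 𝔵 => le_ihom.2 ?_)
    rw [mul_assoc]
    refine qSup_mul_le ?_
    rintro 𝔮 ⟨h1, rfl⟩
    have h2 : powStr X 𝔭 h ≤ _ := (iInf_le _ 𝔮).trans ((iInf_le _ x).trans (iInf_le _ h1))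
    have h3 := le_ihom.1 (le_ihom.1 h2)
    refine le_trans (le_of_eq ?_) h3
    rw [mul_comm, mul_comm (X.str _ _)]
  · refine le_iInf fun 𝔮 => le_iInf fun x => le_iInf fun h1 => le_ihom.2 (le_ihom.2 ?_)
    subst h1
    have h2 : (⨅ x, ihom (mu X (𝕋.map Prod.fst 𝔮) x) (h.1 x)) * mu X (𝕋.map Prod.fst 𝔮) x ≤ h.1 x :=
      le_ihom.1 (iInf_le _ x)
    refine le_trans ?_ h2
    rw [mul_assoc]
    refine mul_le_mul_right ?_ _
    rw [mul_comm]
    exact (mul_le_mul_left (𝕋.le_ext (ev X) 𝔮) _).trans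
      (le_relComp (s := X.str) (r := 𝕋.ext (ev X)) (𝕋.map Prod.snd 𝔮))

theorem mu_map {A : Type u} (X : TCat 𝕋) (g : A → Pow X) (𝔞 : 𝕋.F A) :
    mu X (𝕋.map g 𝔞) = relComp X.str (𝕋.ext (fun z => (g z).1)) 𝔞 := by
  funext x
  exact iSup_congr fun 𝔵 => by rw [← ext_precomp]; rfl

theorem TCat.Equivalent.of_eq {X : TCat 𝕋} {x y : X.carrier} (h : x = y) : X.Equivalent x y := by
  subst h
  exact ⟨X.refl x, X.refl x⟩

theorem IsPseudoHom.lowerStar_eq {X Y : TCat 𝕋} {f : X.carrier → Y.carrier}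
    (hf : IsPseudoHom X Y f) {α : 𝕋.F X.carrier → X.carrier}
    (hα : X.IsLeftAdjointUnit α) (hY : Y.IsRepresentable) (𝔵 : 𝕋.F X.carrier) (y : Y.carrier) :
    lowerStar Y f 𝔵 y = Y.str₀ (f (α 𝔵)) y := by
  obtain ⟨β, hβ⟩ := hY
  have h := hf.equivalent α β hα hβ 𝔵
  rw [lowerStar, hβ.str_eq]
  exact le_antisymm ((le_mul_of_one_le_left' h.2).trans (Y.str₀_trans _ _ y))
    ((le_mul_of_one_le_left' h.1).trans (Y.str₀_trans _ _ y))

theorem IsPseudoHom.relComp_str {X Y : TCat 𝕋} {f : X.carrier → Y.carrier}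
    (hf : IsPseudoHom X Y f) (hX : X.IsRepresentable)
    (hY : Y.IsRepresentable) :
    relComp (fun x y => Y.str₀ (f x) y) X.str = lowerStar Y f := by
  obtain ⟨α, hα⟩ := hX
  funext 𝔵 y
  apply le_antisymm
  · refine iSup_le fun x => ?_
    exact (mul_le_mul_left (hf.isTFunctor 𝔵 x) _).trans (Y.str_mul_str₀ _ _ _)
  · rw [hf.lowerStar_eq hα hY]
    exact (le_mul_of_one_le_left' (hα.one_le_str 𝔵)).trans
      (le_relComp (s := fun x y => Y.str₀ (f x) y) (r := X.str) (α 𝔵))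

theorem Repr.hom_ext {X Y : Repr 𝕋} {f g : X ⟶ Y} (h : ∀ x, f.toFun x = g.toFun x) : f = g :=
  Repr.Hom.ext (funext h)

section

variable [Subsingleton (𝕋.F PUnit.{u + 1})]

theorem act_apply {X Y : Type u} (ψ : 𝕋.F X → Y → V) (φ : X → V) (y : Y) :
    𝕋.act ψ φ y = ⨆ 𝔵, 𝕋.ξ (𝕋.map φ 𝔵) * ψ 𝔵 y := by
  have h : ∀ 𝔛 : 𝕋.F (𝕋.F PUnit.{u + 1}),
      relComp ψ (𝕋.ext (fun (_ : 𝕋.F PUnit.{u + 1}) x => φ x)) 𝔛 y =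
        ⨆ 𝔵, 𝕋.ξ (𝕋.map φ 𝔵) * ψ 𝔵 y := by
    intro 𝔛
    refine iSup_congr fun 𝔵 => ?_
    have h1 := 𝕋.ext_precomp (fun (_ : PUnit.{u + 1}) x => φ x)
      (fun _ : 𝕋.F PUnit.{u + 1} => PUnit.unit) 𝔛 𝔵
    rw [h1, Subsingleton.elim (𝕋.map _ 𝔛) (𝕋.e PUnit.unit), ext_e]
  simp only [act, kconv, h]
  exact le_antisymm (iSup₂_le fun _ _ => le_rfl)
    (le_iSup₂_of_le (𝕋.e (𝕋.e PUnit.unit)) (𝕋.m_e _) le_rfl)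

theorem mu_e (X : TCat 𝕋) (φ : Pow X) (x : X.carrier) : mu X (𝕋.e φ) x = φ.1 x := by
  apply le_antisymm
  · refine iSup_le fun 𝔵 => ?_
    rw [ext_e, mul_comm]
    exact φ.mul_le 𝔵 x
  · refine le_trans ?_ (le_relComp (𝕋.e x))
    exact (𝕋.le_ext_e (ev X) φ x).trans (le_mul_of_one_le_right' (X.refl x))

theorem isTFunctor_relComp {A X : Type u} {Y : TCat 𝕋} {ψ : 𝕋.F X → Y.carrier → V}
    (h : ∀ 𝔛 y, relComp Y.str (𝕋.ext ψ) 𝔛 y ≤ ψ (𝕋.m 𝔛) y) (s : A → X → V) (𝔞 : 𝕋.F A) :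
    𝕋.IsTFunctor Y.str 𝕋.homξ (relComp ψ (𝕋.ext s) 𝔞) := by
  rw [isTFunctor_homξ_iff]
  intro 𝔶 y
  have h1 := 𝕋.relComp_ext_ext_le h s (𝕋.e 𝔞) y
  rw [m_e] at h1
  refine le_trans ?_ h1
  refine le_trans ?_ (le_relComp 𝔶)
  rw [ext_e, mul_comm]

/-- The function `T(V^X) → V^X` induced by `μ`. -/
def mate (X : TCat 𝕋) (𝔭 : 𝕋.F (Pow X)) : Pow X :=
  ⟨mu X 𝔭, isTFunctor_relComp X.comp_le (ev X) 𝔭⟩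

/-- The exponential `V^X` is dualisable: its structure has the form `a = a₀ · α`. -/
theorem powStr_dualisable (X : TCat 𝕋) (𝔭 : 𝕋.F (Pow X)) (h : Pow X) :
    powStr X 𝔭 h = 𝕋.under (powStr X) (mate X 𝔭) h := by
  simp only [under, powStr_eq, mu_e]
  rfl

/-- The structure of `VX` is the dual `a₀° · α` of the structure of `V^X`. -/
theorem vStr_eq_dual (X : TCat 𝕋) (𝔭 : 𝕋.F (Pow X)) (h : Pow X) :
    vStr X 𝔭 h = 𝕋.under (powStr X) h (mate X 𝔭) := by
  simp only [under, powStr_eq, mu_e]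
  rfl

/-- The Yoneda map `X → VX`. -/
def yoneda (X : TCat 𝕋) (x : X.carrier) : Pow X :=
  ⟨X.str₀ x, isTFunctor_homξ_iff.2 fun 𝔵 y => by
    rw [← ext_e, mul_comm]
    exact X.ext_str₀_mul_str (𝕋.e x) 𝔵 y⟩

theorem vStr_yoneda (X : TCat 𝕋) (𝔭 : 𝕋.F (Pow X)) (x : X.carrier) :
    vStr X 𝔭 (yoneda X x) = mu X 𝔭 x := by
  apply le_antisymm
  · exact (le_mul_of_one_le_right' (X.refl x)).trans (vStr_mul_le X 𝔭 (yoneda X x) x)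
  · refine le_vStr.2 fun y => ?_
    have h : relComp X.str₀ (mu X) = mu X := by
      rw [mu, relComp_assoc, X.relComp_str₀_str]
    have h1 := le_relComp (s := X.str₀) (r := mu X) (x := 𝔭) (z := y) x
    rwa [h] at h1

theorem str₀_yoneda (X : TCat 𝕋) (φ : Pow X) (x : X.carrier) :
    X.vietoris.str₀ φ (yoneda X x) = φ.1 x := (vStr_yoneda X _ x).trans (mu_e X φ x)

/-- `Vf = f_⊛ ∘ -`. -/
def vMap (X Y : TCat 𝕋) (f : X.carrier → Y.carrier) (φ : Pow X) : Pow Y :=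
  ⟨𝕋.act (lowerStar Y f) φ.1, by
    have h : 𝕋.act (lowerStar Y f) φ.1 = relComp (lowerStar Y f) (𝕋.ext (ev X)) (𝕋.e φ) := by
      funext y
      rw [act_apply]
      exact iSup_congr fun 𝔵 => by rw [ext_e]; rfl
    rw [h]
    refine isTFunctor_relComp (fun 𝔛 y => ?_) _ _
    have h1 : 𝕋.ext (lowerStar Y f) = fun 𝔛 𝔶 => 𝕋.ext Y.str (𝕋.map (𝕋.map f) 𝔛) 𝔶 := by
      funext 𝔛 𝔶
      exact 𝕋.ext_precomp Y.str (𝕋.map f) 𝔛 𝔶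
    rw [h1]
    refine (Y.comp_le (𝕋.map (𝕋.map f) 𝔛) y).trans_eq ?_
    rw [← map_m]
    rfl⟩

theorem act_upperStar (X : TCat 𝕋) (Φ : Pow X.vietoris) (x : X.carrier) :
    𝕋.act (upperStar X.vietoris (yoneda X)) Φ.1 x = Φ.1 (yoneda X x) := by
  rw [act_apply]
  apply le_antisymm
  · refine iSup_le fun 𝔭 => ?_
    rw [mul_comm]
    exact Φ.mul_le 𝔭 (yoneda X x)
  · refine le_trans ?_ (le_iSup _ (𝕋.e (yoneda X x)))
    rw [ξ_map_e]
    exact le_mul_of_one_le_right' (X.vietoris.refl (yoneda X x))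

theorem yoneda_isTFunctor (X : TCat 𝕋) : 𝕋.IsTFunctor X.str X.vietoris.str (yoneda X) := by
  intro 𝔵 x
  refine le_of_eq ?_
  change _ = vStr X _ _
  rw [vStr_yoneda, mu_map]
  exact (congrFun (congrFun X.relComp_str_ext_str₀ 𝔵) x).symm

/-- The multiplication `y^⊛ ∘ -` at `X`. -/
def vMult (X : TCat 𝕋) (Φ : Pow X.vietoris) : Pow X :=
  ⟨𝕋.act (upperStar X.vietoris (yoneda X)) Φ.1, by
    rw [funext (act_upperStar X Φ)]
    exact IsTFunctor.comp Φ.2 (yoneda_isTFunctor X)⟩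

theorem vMult_apply (X : TCat 𝕋) (Φ : Pow X.vietoris) (x : X.carrier) :
    (vMult X Φ).1 x = Φ.1 (yoneda X x) := act_upperStar X Φ x

theorem vMult_apply' (X : TCat 𝕋) (Φ : Pow X.vietoris) (x : X.carrier) :
    (vMult X Φ).1 x = ⨆ φ : Pow X, Φ.1 φ * φ.1 x := by
  rw [vMult_apply]
  apply le_antisymm
  · exact (le_mul_of_one_le_right' (X.refl x)).trans
      (le_iSup (fun φ : Pow X => Φ.1 φ * φ.1 x) (yoneda X x))
  · refine iSup_le fun φ => ?_
    rw [mul_comm, ← str₀_yoneda X φ x]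
    exact Φ.str₀_mul_le φ (yoneda X x)

theorem mate_isLeftAdjointUnit {X : TCat 𝕋} (hX : X.IsRepresentable) :
    X.vietoris.IsLeftAdjointUnit (mate X) where
  isTFunctor 𝔓 𝔭 := by
    obtain ⟨α, hα⟩ := hX
    refine iSup₂_le fun 𝔔 h𝔔 => ?_
    refine le_vStr.2 fun x => ?_
    have h1 : 𝕋.ext (vStr X) 𝔔 𝔭 * mu X 𝔭 x ≤ mu X (𝕋.m 𝔓) x :=
      ((le_relComp 𝔭).trans (mu_relComp_le X 𝔔 x)).trans_eq (by rw [← h𝔔])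
    refine h1.trans ?_
    rw [mu_map]
    exact 𝕋.le_relComp_ext_ext hα.le_comp (ev X) 𝔓 x
  unit 𝔭 := by
    refine le_trans ?_ (le_freeStr X.vietoris.str (𝔜 := 𝕋.e 𝔭) rfl (𝕋.e (mate X 𝔭)))
    refine le_trans ?_ (𝕋.le_ext_e X.vietoris.str 𝔭 (mate X 𝔭))
    exact le_vStr.2 fun x => (one_mul _).le
  counit φ := by
    refine le_vStr.2 fun x => ?_
    rw [mu_e, one_mul]
    exact (mu_e X φ x).ge

theorem vietoris_isRepresentable {X : TCat 𝕋} (hX : X.IsRepresentable) :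
    X.vietoris.IsRepresentable := ⟨mate X, mate_isLeftAdjointUnit hX⟩

theorem yoneda_isPseudoHom {X : TCat 𝕋} (hX : X.IsRepresentable) :
    IsPseudoHom X X.vietoris (yoneda X) := by
  obtain ⟨α, hα⟩ := hX
  refine .of_eq (yoneda_isTFunctor X) hα (mate_isLeftAdjointUnit ⟨α, hα⟩) fun 𝔵 => .of_eq ?_
  refine Pow.ext fun x => ?_
  change mu X (𝕋.map (yoneda X) 𝔵) x = X.str₀ (α 𝔵) x
  rw [mu_map, ← hα.str_eq]
  exact congrFun (congrFun X.relComp_str_ext_str₀ 𝔵) x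

theorem vMult_isPseudoHom {X : TCat 𝕋} (hX : X.IsRepresentable) :
    IsPseudoHom X.vietoris.vietoris X.vietoris (vMult X) := by
  have hmu : ∀ (𝔓 : 𝕋.F (Pow X.vietoris)) (x : X.carrier),
      mu X (𝕋.map (vMult X) 𝔓) x = mu X.vietoris 𝔓 (yoneda X x) := by
    intro 𝔓 x
    have h1 : (fun Φ => (vMult X Φ).1) = relComp (ev X) (ev X.vietoris) := by
      funext Φ x
      exact vMult_apply' X Φ x
    rw [mu_map, h1, ext_comp, relComp_assoc]
    refine iSup_congr fun 𝔭 => ?_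
    exact congrArg _ (vStr_yoneda X 𝔭 x).symm
  refine .of_eq (fun 𝔓 Φ => ?_) (mate_isLeftAdjointUnit (vietoris_isRepresentable hX))
    (mate_isLeftAdjointUnit hX) fun 𝔓 => .of_eq ?_
  · refine le_vStr.2 fun x => ?_
    rw [hmu, vMult_apply]
    exact vStr_mul_le X.vietoris 𝔓 Φ (yoneda X x)
  · refine Pow.ext fun x => ?_
    rw [vMult_apply]
    exact hmu 𝔓 x

section PseudoHom

variable {X Y : TCat 𝕋} {f : X.carrier → Y.carrier}

theorem IsPseudoHom.vMap_apply (hf : IsPseudoHom X Y f) (hX : X.IsRepresentable)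
    (hY : Y.IsRepresentable) (φ : Pow X) (y : Y.carrier) :
    (vMap X Y f φ).1 y = ⨆ x, φ.1 x * Y.str₀ (f x) y := by
  obtain ⟨α, hα⟩ := hX
  refine (act_apply _ _ _).trans (le_antisymm ?_ ?_)
  · refine iSup_le fun 𝔵 => ?_
    rw [hf.lowerStar_eq hα hY]
    refine le_trans (mul_le_mul_left ?_ _)
      (le_iSup (fun x => φ.1 x * Y.str₀ (f x) y) (α 𝔵))
    exact (le_mul_of_one_le_left' (hα.one_le_str 𝔵)).trans (φ.mul_le 𝔵 (α 𝔵))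
  · refine iSup_le fun x => ?_
    refine le_trans ?_ (le_iSup _ (𝕋.e x))
    rw [ξ_map_e, lowerStar, map_e]
    rfl

theorem IsPseudoHom.mu_map_vMap (hf : IsPseudoHom X Y f) (hX : X.IsRepresentable)
    (hY : Y.IsRepresentable) (𝔭 : 𝕋.F (Pow X)) :
    mu Y (𝕋.map (vMap X Y f) 𝔭) = (vMap X Y f (mate X 𝔭)).1 := by
  have h1 : (fun φ => (vMap X Y f φ).1) = relComp (fun x y => Y.str₀ (f x) y) (ev X) := by
    funext φ y
    exact hf.vMap_apply hX hY φ y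
  have h2 : relComp Y.str (𝕋.ext (fun x y => Y.str₀ (f x) y)) = lowerStar Y f := by
    funext 𝔵 y
    refine Eq.trans ?_ (congrFun (congrFun Y.relComp_str_ext_str₀ (𝕋.map f 𝔵)) y)
    exact iSup_congr fun 𝔶 => by rw [ext_precomp]
  rw [mu_map, h1, ext_comp, relComp_assoc, h2, ← hf.relComp_str hX hY, ← relComp_assoc]
  funext y
  exact (hf.vMap_apply hX hY (mate X 𝔭) y).symm

theorem IsPseudoHom.vMap (hf : IsPseudoHom X Y f) (hX : X.IsRepresentable)
    (hY : Y.IsRepresentable) : IsPseudoHom X.vietoris Y.vietoris (vMap X Y f) := by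
  refine .of_eq (fun 𝔭 φ => ?_) (mate_isLeftAdjointUnit hX) (mate_isLeftAdjointUnit hY)
    fun 𝔭 => .of_eq (Subtype.ext (hf.mu_map_vMap hX hY 𝔭))
  refine le_vStr.2 fun y => ?_
  rw [hf.mu_map_vMap hX hY, hf.vMap_apply hX hY, hf.vMap_apply hX hY, Quantale.mul_iSup_distrib]
  refine iSup_mono fun x => ?_
  rw [← mul_assoc]
  exact mul_le_mul_left (vStr_mul_le X 𝔭 φ x) _

end PseudoHom

/-! ## The Vietoris monad on `Repr(𝕋)` -/

theorem Repr.vMap_apply {X Y : Repr 𝕋} (f : X ⟶ Y) (φ : Pow X.toTCat) (y : Y.carrier) :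
    (vMap X.toTCat Y.toTCat f.toFun φ).1 y = ⨆ x, φ.1 x * Y.str₀ (f.toFun x) y :=
  f.isPseudoHom.vMap_apply X.isRepresentable Y.isRepresentable φ y

/-- `V` as an endofunctor of `Repr(𝕋)`. -/
@[reducible]
def vFunctor : Repr 𝕋 ⥤ Repr 𝕋 where
  obj X := ⟨X.vietoris, vietoris_isRepresentable X.isRepresentable⟩
  map {X Y} f := ⟨vMap X.toTCat Y.toTCat f.toFun,
    f.isPseudoHom.vMap X.isRepresentable Y.isRepresentable⟩
  map_id X := Repr.hom_ext fun φ => Pow.ext fun y => by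
    refine (Repr.vMap_apply (𝟙 X) φ y).trans (le_antisymm ?_ ?_)
    · refine iSup_le fun x => ?_
      rw [mul_comm]
      exact Pow.str₀_mul_le φ x y
    · exact (le_mul_of_one_le_right' (X.refl y)).trans
        (le_iSup (fun x => φ.1 x * X.str₀ x y) y)
  map_comp {X Y Z} f g := Repr.hom_ext fun φ => Pow.ext fun z => by
    refine (Repr.vMap_apply (f ≫ g) φ z).trans ?_
    refine Eq.trans ?_ (Repr.vMap_apply g (vMap X.toTCat Y.toTCat f.toFun φ) z).symm
    simp only [Repr.vMap_apply, Quantale.iSup_mul_distrib]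
    rw [iSup_comm]
    refine iSup_congr fun x => ?_
    simp only [mul_assoc]
    rw [← Quantale.mul_iSup_distrib]
    congr 1
    apply le_antisymm
    · exact (le_mul_of_one_le_left' (Y.refl (f.toFun x))).trans
        (le_iSup (fun y => Y.str₀ (f.toFun x) y * Z.str₀ (g.toFun y) z) (f.toFun x))
    · exact iSup_le fun y => (mul_le_mul_left (g.isPseudoHom.isTFunctor.le _ _) _).trans
        (Z.str₀_trans _ _ z)

variable (𝕋) in
/-- The Vietoris monad on `Repr(𝕋)`. -/
def vietorisMonad : CategoryTheory.Monad (Repr 𝕋) where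
  toFunctor := vFunctor
  η :=
    { app X := ⟨yoneda X.toTCat, yoneda_isPseudoHom X.isRepresentable⟩
      naturality X Y f := Repr.hom_ext fun x => Pow.ext fun y => by
        refine Eq.trans ?_ (Repr.vMap_apply f (yoneda X.toTCat x) y).symm
        apply le_antisymm
        · exact (le_mul_of_one_le_left' (X.refl x)).trans
            (le_iSup (fun x' => X.str₀ x x' * Y.str₀ (f.toFun x') y) x)
        · exact iSup_le fun x' => (mul_le_mul_left (f.isPseudoHom.isTFunctor.le _ _) _).trans
            (Y.str₀_trans _ _ y) }
  μ :=
    { app X := ⟨vMult X.toTCat, vMult_isPseudoHom X.isRepresentable⟩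
      naturality X Y f := Repr.hom_ext fun Φ => Pow.ext fun y => by
        refine (vMult_apply Y.toTCat _ y).trans ?_
        refine (Repr.vMap_apply (vFunctor.map f) Φ (yoneda Y.toTCat y)).trans ?_
        refine Eq.trans ?_ (Repr.vMap_apply f (vMult X.toTCat Φ) y).symm
        simp only [vMult_apply', Quantale.iSup_mul_distrib]
        rw [iSup_comm]
        refine iSup_congr fun φ => ?_
        have h := str₀_yoneda Y.toTCat ((vFunctor.map f).toFun φ) y
        refine (congrArg _ h).trans ?_
        refine (congrArg _ (Repr.vMap_apply f φ y)).trans ?_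
        simp only [Quantale.mul_iSup_distrib, mul_assoc] }
  assoc X := Repr.hom_ext fun Ψ => Pow.ext fun x => by
    refine (vMult_apply X.toTCat _ x).trans ?_
    refine Eq.trans ?_ (vMult_apply X.toTCat (vMult X.vietoris Ψ) x).symm
    refine Eq.trans ?_ (vMult_apply' X.vietoris Ψ (yoneda X.toTCat x)).symm
    refine (IsPseudoHom.vMap_apply (vMult_isPseudoHom X.isRepresentable)
      (vietoris_isRepresentable (vietoris_isRepresentable X.isRepresentable))
      (vietoris_isRepresentable X.isRepresentable) Ψ (yoneda X.toTCat x)).trans ?_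
    refine iSup_congr fun Φ => ?_
    rw [str₀_yoneda, vMult_apply]
  left_unit X := Repr.hom_ext fun φ => Pow.ext fun x =>
    (vMult_apply X.toTCat _ x).trans (str₀_yoneda X.toTCat φ x)
  right_unit X := Repr.hom_ext fun φ => Pow.ext fun x => by
    refine (vMult_apply X.toTCat _ x).trans ?_
    refine (IsPseudoHom.vMap_apply (yoneda_isPseudoHom X.isRepresentable) X.isRepresentable
      (vietoris_isRepresentable X.isRepresentable) φ (yoneda X.toTCat x)).trans ?_
    simp only [str₀_yoneda]
    apply le_antisymm
    · refine iSup_le fun x' => ?_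
      rw [mul_comm]
      exact Pow.str₀_mul_le φ x' x
    · exact (le_mul_of_one_le_right' (X.refl x)).trans
        (le_iSup (fun x' => φ.1 x' * (yoneda X.toTCat x').1 x) x)

/-- The `V`-relation `(x, y) ↦ r(x)(y)` of a morphism `r : X → VY` of the Kleisli category. -/
def umate {X Y : Kleisli (vietorisMonad 𝕋)} (r : X ⟶ Y) : X.of.carrier → Y.of.carrier → V :=
  fun x y => (r.of.toFun x : Pow Y.of.toTCat).1 y

end

end TopologicalTheory

/-! ### Pseudo-homomorphisms into `VY` are distributors -/

namespace TopologicalTheory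

variable {V : Type u} [CommMonoid V] [CompleteLattice V] [IsQuantale V]
variable {𝕋 : TopologicalTheory V} [Subsingleton (𝕋.F PUnit.{u + 1})]

/-! Kleisli morphisms from `X` to `Y` are pseudo-homomorphisms `r : X → VY`. Uncurrying makes `r` a
`V`-relation `ψ(x, y) = r(x)(y)`, and the point is that the defining conditions on the two sides
match. Write `a`, `b` for the structures of `X`, `Y`, and `α` for a left adjoint of the unit of `X`.

The structure of `VY` compares a function with `μ_Y = b · T_ξ ev`, and `mu_map` gives `μ_Y · Tr = b
· T_ξ ψ`. Hence `r` is a `𝕋`-functor exactly when `a(𝔵, x) ⊗ ψ(x, y) ≤ (b · T_ξ ψ)(𝔵, y)` for all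
`𝔵, x, y`, that is, when `ψ · a ≤ b · T_ξ ψ`.

The left adjoint of the unit of `VY` is `mate Y`, which sends `𝔭` to `μ_Y(𝔭, -)`; so the
pseudo-homomorphism condition reads `(b · T_ξ ψ)(𝔵, -) = ψ(α 𝔵, -)`. Representability of `X` gives
`a = a₀ · α`, and a distributor satisfies `ψ · a₀ = ψ`, so `ψ · a = ψ · α`. Thus the condition
amounts to `ψ · a = b · T_ξ ψ`. Conversely, this equation read at `e x`, where `T1 = 1` enters
through `ext_e`, shows that every row `ψ(x, -)` is a point of `VY`.

Composition agrees by a Yoneda argument: the multiplication evaluates at representables `y(z)`, the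
action of `V` on a pseudo-homomorphism is given by a supremum over points (`Repr.vMap_apply`), and
pairing a function with `y(z)` returns its value at `z` (`str₀_yoneda`). The units are `a₀` on both
sides. Uncurrying is therefore a functor, bijective on hom-sets and on objects. -/

/-- `μ_Y` restricted along the unit is evaluation, by `mu_e`. At `v = 1` this shows that the order
of `VY` is the reverse of the pointwise order, so equivalent points of `VY` are equal. -/
theorem vietoris_str₀_le_iff {Y : TCat 𝕋} {φ ψ : Pow Y} {v : V} :
    v ≤ Y.vietoris.str₀ φ ψ ↔ ∀ y, v * ψ.1 y ≤ φ.1 y := by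
  refine le_vStr.trans (forall_congr' fun y => ?_)
  rw [mu_e]

/-- A pseudo-homomorphism `X → VY` is a morphism from `X` to `Y` in `ReprDist(𝕋)`. -/
theorem IsPseudoHom.isReprDist {X Y : TCat 𝕋} {r : X.carrier → Pow Y}
    (hr : IsPseudoHom X Y.vietoris r) (hX : X.IsRepresentable) (hY : Y.IsRepresentable) :
    IsReprDist X Y (fun x => (r x).1) where
  isVDistributor :=
    -- Compatibility with `a₀` is monotonicity of `r` for the reversed order of `VY`; compatibility
    -- with `b₀` holds because each `r x` is itself a `𝕋`-functor on `Y`.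
    ⟨fun x y => iSup_le fun x' => vietoris_str₀_le_iff.1 (hr.isTFunctor.le x x') y,
      fun x y => iSup_le fun y' => (mul_comm _ _).trans_le ((r x).str₀_mul_le y' y)⟩
  comm := by
    obtain ⟨α, hα⟩ := hX
    funext 𝔵 y
    -- The right-hand side becomes `μ_Y(Tr 𝔵, y)`, the quantity that both the structure of `VY` and
    -- its left adjoint `mate Y` are built from.
    rw [← mu_map Y r]
    apply le_antisymm
    -- This inequality is functoriality of `r`, transposed along the internal hom.
    · exact iSup_le fun x => le_vStr.1 (hr.isTFunctor 𝔵 x) y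
    -- Only one half of the equivalence is needed: `r(α 𝔵)` below `mate Y (Tr 𝔵)` in `VY`, which
    -- pointwise means `μ_Y(Tr 𝔵, -) ≤ r(α 𝔵)`. The supremum `ψ · a` is then bounded below by its
    -- term at `α 𝔵`, because `1 ≤ a(𝔵, α 𝔵)`.
    · have h := vietoris_str₀_le_iff.1
        (hr.equivalent α (mate Y) hα (mate_isLeftAdjointUnit hY) 𝔵).2 y
      rw [one_mul] at h
      exact (h.trans (le_mul_of_one_le_left' (hα.one_le_str 𝔵))).trans
        (le_relComp (s := fun x => (r x).1) (α 𝔵))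

/-! ### From distributors back to maps into `VY` -/

/-- The `V`-valued functions `ψ x` of a morphism `ψ` of `ReprDist(𝕋)` are `𝕋`-functors. -/
theorem IsReprDist.isTFunctor_homξ {X Y : TCat 𝕋} {ψ : X.carrier → Y.carrier → V}
    (hψ : IsReprDist X Y ψ) (x : X.carrier) : 𝕋.IsTFunctor Y.str 𝕋.homξ (ψ x) := by
  refine isTFunctor_homξ_iff.2 fun 𝔶 y => ?_
  -- Since `T1 = 1`, the factor `ξ(T(ψ x) 𝔶)` is the value of `T_ξ ψ` at `(e x, 𝔶)`, so the product
  -- is one term of `(b · T_ξ ψ)(e x, y)`.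
  rw [← 𝕋.ext_e ψ, mul_comm]
  refine (le_relComp (s := Y.str) (r := 𝕋.ext ψ) 𝔶).trans ?_
  rw [← hψ.comm]
  -- At `e x` the relation `ψ · a` is `ψ · a₀` by definition.
  exact hψ.isVDistributor.1 x y

/-- The map `X → VY` of a morphism from `X` to `Y` in `ReprDist(𝕋)`. -/
def IsReprDist.toPow {X Y : TCat 𝕋} {ψ : X.carrier → Y.carrier → V} (hψ : IsReprDist X Y ψ)
    (x : X.carrier) : Pow Y := ⟨ψ x, hψ.isTFunctor_homξ x⟩

/-- The equation `ψ · a = b · T_ξ ψ` identifies `μ_Y(Tr 𝔵, -)` with `(ψ · a)(𝔵, -)`. Functoriality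
then says that one term lies below a supremum, and the homomorphism condition follows from `a = a₀ ·
α`. -/
theorem IsReprDist.isPseudoHom_toPow {X Y : TCat 𝕋} {ψ : X.carrier → Y.carrier → V}
    (hψ : IsReprDist X Y ψ) (hX : X.IsRepresentable) (hY : Y.IsRepresentable) :
    IsPseudoHom X Y.vietoris hψ.toPow := by
  obtain ⟨α, hα⟩ := hX
  have hmu : ∀ 𝔵, mu Y (𝕋.map hψ.toPow 𝔵) = relComp ψ X.str 𝔵 := fun 𝔵 =>
    (mu_map Y hψ.toPow 𝔵).trans (congrFun hψ.comm 𝔵).symm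
  -- One choice of left adjoints suffices. For this choice the homomorphism condition holds as an
  -- equality of points of `VY`, not merely up to equivalence.
  refine .of_eq (fun 𝔵 x => le_vStr.2 fun y => ?_) hα (mate_isLeftAdjointUnit hY)
    fun 𝔵 => .of_eq (Subtype.ext ?_)
  · rw [hmu]
    exact le_relComp (s := ψ) x
  -- Both sides are compared with `(ψ · a₀)(α 𝔵, -)`: it equals `(ψ · a)(𝔵, -)` by `str_eq`, and
  -- `ψ(α 𝔵, -)` because `ψ` is a distributor.
  · refine (hmu 𝔵).trans (Eq.trans ?_ (congrFun hψ.relComp_str₀ (α 𝔵)))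
    funext y
    exact iSup_congr fun x => by rw [hα.str_eq]

/-! ### Kleisli identities and composites, and the comparison functor -/

theorem umate_id (X : Kleisli (vietorisMonad 𝕋)) : umate (𝟙 X) = X.of.str₀ := rfl

/-- The Kleisli composite is `w · Vs · r`. Evaluating `w` at `z` evaluates its argument at the
representable `y(z)`, which turns the composite into the supremum over `y` of `r(x)(y)` times the
pairing of `s(y)` with `y(z)`; by Yoneda that pairing is `s(y)(z)`. -/
theorem umate_comp {X Y Z : Kleisli (vietorisMonad 𝕋)} (r : X ⟶ Y) (s : Y ⟶ Z) :
    umate (r ≫ s) = relComp (umate s) (umate r) := by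
  funext x z
  refine (vMult_apply Z.of.toTCat _ z).trans ((Repr.vMap_apply s.of _ _).trans ?_)
  exact iSup_congr fun y => congrArg _ (str₀_yoneda Z.of.toTCat _ z)

variable (𝕋) in
/-- The functor from the Kleisli category of the Vietoris monad to `ReprDist(𝕋)` that sends
`r : X → VY` to the `V`-relation `(x, y) ↦ r(x)(y)`. -/
def kleisliToReprDist : Kleisli (vietorisMonad 𝕋) ⥤ ReprDist 𝕋 where
  obj X := ⟨X.of⟩
  map {X Y} r := ⟨umate r,
    r.of.isPseudoHom.isReprDist X.of.isRepresentable Y.of.isRepresentable⟩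
  map_id X := ReprDist.Hom.ext (umate_id X)
  map_comp r s := ReprDist.Hom.ext (umate_comp r s)

instance : (kleisliToReprDist 𝕋).Faithful where
  map_injective {_ _} _ _ h := Kleisli.Hom.ext (Repr.hom_ext fun x =>
    Subtype.ext (congrFun (congrArg ReprDist.Hom.rel h) x))

/-- Currying followed by uncurrying is definitionally the identity, so the preimage of `ψ` is its
map into `VY`. -/
instance : (kleisliToReprDist 𝕋).Full where
  map_surjective {X Y} ψ := ⟨⟨⟨ψ.isReprDist.toPow,
    ψ.isReprDist.isPseudoHom_toPow X.of.isRepresentable Y.of.isRepresentable⟩⟩, rfl⟩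

instance : (kleisliToReprDist 𝕋).EssSurj where
  -- Both categories wrap the same representable `𝕋`-categories, so every object is hit on the nose.
  mem_essImage X := ⟨.mk _ X.of, ⟨Iso.refl X⟩⟩

instance : (kleisliToReprDist 𝕋).IsEquivalence where

end TopologicalTheory

theorem mainTheorem3 {V : Type u} [CommMonoid V] [CompleteLattice V] [IsQuantale V]
    (𝕋 : TopologicalTheory V) [Subsingleton (𝕋.F PUnit.{u + 1})] :
    ∃ (E : Kleisli 𝕋.vietorisMonad ≌ 𝕋.ReprDist)
      (h : ∀ X : Kleisli 𝕋.vietorisMonad, E.functor.obj X = TopologicalTheory.ReprDist.mk X.of),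
      ∀ (X Y : Kleisli 𝕋.vietorisMonad) (r : X ⟶ Y) (x : X.of.carrier) (y : Y.of.carrier),
        (eqToHom (h X).symm ≫ E.functor.map r ≫ eqToHom (h Y)).rel x y =
          TopologicalTheory.umate r x y := by
  refine ⟨(TopologicalTheory.kleisliToReprDist 𝕋).asEquivalence, fun _ => rfl,
    fun X Y r x y => ?_⟩
  -- The object equality holds by `rfl`, so both transports are identities up to definitional
  -- unfolding and cancel.
  have h := (Category.id_comp ((TopologicalTheory.kleisliToReprDist 𝕋).map r ≫ 𝟙 _)).trans
    (Category.comp_id _)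
  exact congrFun (congrFun (congrArg TopologicalTheory.ReprDist.Hom.rel h) x) y
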